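/- Let $p$ be a prime number and let $F(x)\in\mathbb Z[x]$ be a monic irreducible polynomial of degree four. For $s\in\mathbb Z$ write $F(x)=\sum_{i=0}^{4}a_i(x-s)^i$, so that $a_i=F^{(i)}(s)/i!$, and put $u_i=v_p(a_i)\in\mathbb Z_{\ge0}\cup\{\infty\}$. Let $N^-_{x-s}(F)$ be the polygon formed by the sides of negative slope of the lower convex envelope of the points $(i,u_i)$, $u_i<\infty$. Let $S$ be a side of $N^-_{x-s}(F)$ with slope $-h/e$ ($h,e$ positive coprime integers), with end points of abscissas $i_0<j_0$, and put $d=(j_0-i_0)/e$. Its residual polynomial is $\sum_{k=0}^{d}c_{i_0+ke}\,y^k\in\mathbb F_p[y]$, where $c_i=\overline{a_i/p^{u_i}}$ if $(i,u_i)$ lies on $S$, and $c_i=0$ otherwise. The integer $s$ is called regular if the residual polynomials of all sides of $N^-_{x-s}(F)$ are separable (that is, $F$ is $(x-s)$-regular), and irregular otherwise. Consider the initial conditions (i) $u_2=0$, $u_1>0$, $u_0>0$; (ii) $u_3=0$, $u_2>0$, $u_1>0$, $u_0>0$; (iii) $u_0>2u_2$, $u_1>\frac32u_2$, $u_3\ge\frac12u_2>0$,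 and the side of $N^-_{x-s}(F)$ with end points $(2,u_2)$ and $(4,0)$ has a separable residual polynomial. Let $s$ be an irregular integer satisfying one of (i), (ii), (iii). An iteration replaces $s$ by $t=s+yp^{\delta}$, where $-\delta$ is the slope of the side of $N^-_{x-s}(F)$ whose residual polynomial is inseparable, and $y\in\mathbb Z$ is any integer whose reduction modulo $p$ is the multiple root of that residual polynomial. Then: 1. The iteration can be repeated as long as the current integer is irregular: every integer $m$ obtained from $s$ by finitely many iterations satisfies again one of (i), (ii), (iii), and if $m$ is irregular, then exactly one side of $N^-_{x-m}(F)$ has an inseparable residual polynomial, its slope is $-\delta$ for a positive integer $\delta$, its residual polynomial has exactly one multiple root in $\mathbb F_p$, and all multiple irreducible factors of that polynomial have degree one. 2. Whatever lifts $y$ are chosen, after a finite number of iterations $s_0=s,\ s_1,\dots,s_n$ one reaches a regular integer $s_n$. -/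

import Mathlib

open Polynomial

namespace OrePolygon

/-- The coefficient `a_i` of the `(x - s)`-adic development `F = ∑ a_i (x - s)^i`; it equals
`F^{(i)}(s) / i!`. -/
noncomputable def coeffAt (F : ℤ[X]) (s : ℤ) (i : ℕ) : ℤ := (taylor s F).coeff i

/-- `u_i = v_p(a_i)`, with value `⊤` when `a_i = 0`. -/
noncomputable def val (p : ℕ) (F : ℤ[X]) (s : ℤ) (i : ℕ) : ℕ∞ :=
  emultiplicity (p : ℤ) (coeffAt F s i)

/-- A segment of the plane with end points `(i, a)` (left) and `(j, b)` (right). -/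
structure Segment where
  i : ℕ
  a : ℕ
  j : ℕ
  b : ℕ

namespace Segment

/-- The slope of the line through the end points. -/
def slope (S : Segment) : ℚ := ((S.b : ℚ) - S.a) / ((S.j : ℚ) - S.i)

/-- The ordinate, at the abscissa `k`, of the line through the end points. -/
def height (S : Segment) (k : ℕ) : ℚ := S.a + S.slope * ((k : ℚ) - S.i)

/-- The ramification index `e` of the segment: its slope is `-h/e` in lowest terms. -/
def ram (S : Segment) : ℕ := S.slope.den

/-- The degree `d = ℓ / e` of the segment, where `ℓ = j - i` is its length. -/
def degree (S : Segment) : ℕ := (S.j - S.i) / S.ram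

end Segment

/-- `S` is one of the sides of the principal polygon `N⁻_{x-s}(F)`, that is, one of the sides of
negative slope of the lower convex envelope of the points `(k, u_k)` with `u_k < ∞`: its end points
are points of this set, every point of the set lies on or above the line through them, and the
points on that line have abscissa between those of the end points (so `S` is a whole side). -/
def IsPrincipalSide (p : ℕ) (F : ℤ[X]) (s : ℤ) (S : Segment) : Prop :=
  S.i < S.j ∧ S.slope < 0 ∧ val p F s S.i = S.a ∧ val p F s S.j = S.b ∧
    ∀ k n : ℕ, val p F s k = n →
      S.height k ≤ n ∧ (S.height k = n → S.i ≤ k ∧ k ≤ S.j)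

open Classical in
/-- The residual coefficient `c_k` at an abscissa `k` of the side `S`: the class modulo `p` of
`a_k / p^{u_k}` if the point `(k, u_k)` lies on `S`, and `0` if it lies strictly above `S` or
`u_k = ∞`. The residue field attached to `x - s` is `ZMod p`. -/
noncomputable def residualCoeff (p : ℕ) (F : ℤ[X]) (s : ℤ) (S : Segment) (k : ℕ) : ZMod p :=
  if val p F s k ≠ ⊤ ∧ S.height k = ((val p F s k).toNat : ℚ) then
    ((coeffAt F s k / (p : ℤ) ^ (val p F s k).toNat : ℤ) : ZMod p)
  else 0

/-- The residual polynomial `c_i + c_{i+e} y + ⋯ + c_{i+de} y^d` attached to the side `S`, where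
`i` is the initial abscissa of `S`. -/
noncomputable def residualPoly (p : ℕ) (F : ℤ[X]) (s : ℤ) (S : Segment) : (ZMod p)[X] :=
  ∑ k ∈ Finset.range (S.degree + 1), C (residualCoeff p F s S (S.i + k * S.ram)) * X ^ k

/-- `F` is `(x - s)`-regular (at `p`): the residual polynomials of all the sides of
`N⁻_{x-s}(F)` are separable. -/
def IsRegularAt (p : ℕ) (F : ℤ[X]) (s : ℤ) : Prop :=
  ∀ S : Segment, IsPrincipalSide p F s S → (residualPoly p F s S).Separable

/-- `S` is a side of `N⁻_{x-s}(F)` whose residual polynomial is inseparable. -/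
def IsIrregularSide (p : ℕ) (F : ℤ[X]) (s : ℤ) (S : Segment) : Prop :=
  IsPrincipalSide p F s S ∧ ¬ (residualPoly p F s S).Separable

/-- `c` is a multiple root of `R`. -/
def IsMultipleRoot {p : ℕ} (R : (ZMod p)[X]) (c : ZMod p) : Prop :=
  2 ≤ R.rootMultiplicity c

/-- The initial conditions (i), (ii), (iii) for a quartic `F` at the integer `s`. The inequalities
`u_1 > (3/2) u_2` and `u_3 ≥ u_2 / 2` of (iii) are written without denominators. -/
def InitialCondition (p : ℕ) (F : ℤ[X]) (s : ℤ) : Prop :=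
  (val p F s 2 = 0 ∧ 0 < val p F s 1 ∧ 0 < val p F s 0) ∨
  (val p F s 3 = 0 ∧ 0 < val p F s 2 ∧ 0 < val p F s 1 ∧ 0 < val p F s 0) ∨
  (2 * val p F s 2 < val p F s 0 ∧ 3 * val p F s 2 < 2 * val p F s 1 ∧
    val p F s 2 ≤ 2 * val p F s 3 ∧ 0 < val p F s 2 ∧
    ∃ S : Segment, IsPrincipalSide p F s S ∧ S.i = 2 ∧ S.j = 4 ∧ S.b = 0 ∧
      (residualPoly p F s S).Separable)

/-- One iteration `s ↦ t = s + y p^δ`, where `-δ` is the slope of a side of `N⁻_{x-s}(F)` with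
inseparable residual polynomial and `y` is any integer whose reduction modulo `p` is a multiple
root of that polynomial. -/
def IterationStep (p : ℕ) (F : ℤ[X]) (s t : ℤ) : Prop :=
  ∃ (S : Segment) (δ : ℕ) (y : ℤ), IsIrregularSide p F s S ∧ S.slope = -(δ : ℚ) ∧
    IsMultipleRoot (residualPoly p F s S) (y : ZMod p) ∧ t = s + y * (p : ℤ) ^ δ

/-- The data used by an iteration at `s` exist and are unique: exactly one side has an inseparable
residual polynomial, its slope is an integer `-δ` with `δ > 0`, its residual polynomial has exactly
one multiple root in `ZMod p`, and all multiple irreducible factors of it are linear. -/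
def IterationWellDefined (p : ℕ) (F : ℤ[X]) (s : ℤ) : Prop :=
  (∃! S : Segment, IsIrregularSide p F s S) ∧
  ∀ S : Segment, IsIrregularSide p F s S →
    (∃ δ : ℕ, 0 < δ ∧ S.slope = -(δ : ℚ)) ∧
    (∃! c : ZMod p, IsMultipleRoot (residualPoly p F s S) c) ∧
    ∀ ψ : (ZMod p)[X], Irreducible ψ → ψ ^ 2 ∣ residualPoly p F s S →
      ∃ c : ZMod p, Associated ψ (X - C c)

end OrePolygon

/-!
Let `S` be a side of integral slope `-δ`, ending at the point `(j, b)`, and put `m = b + δ j`. Then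
`F(s + p ^ δ z) = p ^ m G(z)` with `G` an integral polynomial, congruent modulo `p` to `z ^ i R(z)`,
where `R` is the residual polynomial of `S` and `i` its initial abscissa
(`IsPrincipalSide.exists_scaled`). An iteration translates `G` by a multiple root `y` of `R`:
in the new polygon the points of abscissas `0` and `1` lie strictly above the line of slope `-δ`
through `S`, while the end point `(j, b)` stays (`IsPrincipalSide.step`). So a side which starts at
abscissa `0` or `1` after the iteration is strictly steeper than `S`
(`IsPrincipalSide.slope_lt_of_step`).

Under the initial conditions, an irregular side ends at an abscissa `≤ 3`
(`InitialCondition.right_le_three`): in case (iii) because two sides do not overlap and the side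
over `[2, 4]` is separable. Its residual polynomial has degree at least two, hence its ramification
index is one, its slope is integral, its length is two or three, and it is the only irregular side;
a polynomial of degree at most three over a perfect field that is not separable has exactly one
multiple root and no multiple factor of higher degree (`iterationWellDefined_of_right_le`). The
initial conditions persist (`InitialCondition.step`), so the exponents `δ` strictly increase along
the iterations. As `p ^ δ` divides both `F(s)` and `F'(s)` at an irregular `s`, a Bézout identity
`A F + B F' = N` with `N` a nonzero integer bounds their number (`exists_not_pow_dvd_coeffAt`).
-/

namespace OrePolygon

/-! ### Valuations of the coefficients -/

theorem val_eq_natCast_iff {p : ℕ} {F : ℤ[X]} {s : ℤ} {k n : ℕ} :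
    val p F s k = n ↔
      (p : ℤ) ^ n ∣ coeffAt F s k ∧ ¬ (p : ℤ) ^ (n + 1) ∣ coeffAt F s k :=
  emultiplicity_eq_coe

theorem natCast_le_val_iff {p : ℕ} {F : ℤ[X]} {s : ℤ} {k n : ℕ} :
    (n : ℕ∞) ≤ val p F s k ↔ (p : ℤ) ^ n ∣ coeffAt F s k :=
  pow_dvd_iff_le_emultiplicity.symm

theorem natCast_lt_val_iff {p : ℕ} {F : ℤ[X]} {s : ℤ} {k n : ℕ} :
    (n : ℕ∞) < val p F s k ↔ (p : ℤ) ^ (n + 1) ∣ coeffAt F s k := by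
  rw [← natCast_le_val_iff, Nat.cast_add, Nat.cast_one, ENat.add_one_le_iff (ENat.natCast_ne_top n)]

theorem val_pos_iff {p : ℕ} {F : ℤ[X]} {s : ℤ} {k : ℕ} :
    0 < val p F s k ↔ (p : ℤ) ∣ coeffAt F s k := by
  simpa using natCast_lt_val_iff (p := p) (F := F) (s := s) (k := k) (n := 0)

theorem val_eq_zero_iff {p : ℕ} {F : ℤ[X]} {s : ℤ} {k : ℕ} :
    val p F s k = 0 ↔ ¬ (p : ℤ) ∣ coeffAt F s k := by
  rw [← val_pos_iff, pos_iff_ne_zero, not_not]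

theorem coeffAt_eq_zero_of_val_eq_top {p : ℕ} [hp : Fact p.Prime] {F : ℤ[X]} {s : ℤ} {k : ℕ}
    (h : val p F s k = ⊤) : coeffAt F s k = 0 := by
  by_contra h0
  refine emultiplicity_eq_top.1 h (Int.finiteMultiplicity_iff.2 ⟨?_, h0⟩)
  simpa using hp.out.ne_one

theorem sub_dvd_coeffAt_sub (F : ℤ[X]) (s t : ℤ) (k : ℕ) :
    t - s ∣ coeffAt F t k - coeffAt F s k := by
  simp only [coeffAt, taylor_coeff]
  exact sub_dvd_eval_sub _ _ _

theorem val_pos_congr {p : ℕ} {F : ℤ[X]} {s t : ℤ} (h : (p : ℤ) ∣ t - s) (k : ℕ) :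
    0 < val p F t k ↔ 0 < val p F s k := by
  rw [val_pos_iff, val_pos_iff]
  exact dvd_iff_dvd_of_dvd_sub (h.trans (sub_dvd_coeffAt_sub F s t k))

theorem val_eq_zero_congr {p : ℕ} {F : ℤ[X]} {s t : ℤ} (h : (p : ℤ) ∣ t - s) (k : ℕ) :
    val p F t k = 0 ↔ val p F s k = 0 := by
  rw [← not_iff_not, ← Ne, ← Ne, ← pos_iff_ne_zero, ← pos_iff_ne_zero, val_pos_congr h]

/-! ### Sides of the principal polygon -/

theorem Segment.height_left (S : Segment) : S.height S.i = S.a := by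
  simp [Segment.height]

theorem Segment.height_right {S : Segment} (h : S.i < S.j) : S.height S.j = S.b := by
  have : (S.j : ℚ) - S.i ≠ 0 := sub_ne_zero.2 (by exact_mod_cast h.ne')
  simp only [Segment.height, Segment.slope]
  field_simp
  ring

theorem Segment.height_sub (S : Segment) (k l : ℕ) :
    S.height k - S.height l = S.slope * ((k : ℚ) - l) := by
  simp only [Segment.height]; ring

theorem Segment.eq_of_ends {S T : Segment} (hi : S.i = T.i) (hj : S.j = T.j) (ha : S.a = T.a)
    (hb : S.b = T.b) : S = T := by
  cases S; cases T; simp_all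

theorem IsPrincipalSide.height_le {p : ℕ} {F : ℤ[X]} {s : ℤ} {S : Segment}
    (hS : IsPrincipalSide p F s S) {k n : ℕ} (h : val p F s k = n) : S.height k ≤ n :=
  (hS.2.2.2.2 k n h).1

/-- Two sides whose projections on the horizontal axis overlap in more than a point coincide. -/
theorem IsPrincipalSide.eq_of_overlap {p : ℕ} {F : ℤ[X]} {s : ℤ} {S T : Segment}
    (hS : IsPrincipalSide p F s S) (hT : IsPrincipalSide p F s T)
    (h₁ : S.i < T.j) (h₂ : T.i < S.j) : S = T := by
  obtain ⟨hSij, -, hSa, hSb, hSk⟩ := hS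
  obtain ⟨hTij, -, hTa, hTb, hTk⟩ := hT
  have e1 := hSk _ _ hTa
  have e2 := hSk _ _ hTb
  have e3 := hTk _ _ hSa
  have e4 := hTk _ _ hSb
  have sl := S.height_left
  have sr := S.height_right hSij
  have tl := T.height_left
  have tr := T.height_right hTij
  have d (k : ℕ) : S.height k - T.height k =
      (S.a - S.slope * S.i - T.a + T.slope * T.i) + (S.slope - T.slope) * k := by
    simp only [Segment.height]; ring
  have d1 := d S.i
  have d2 := d S.j
  have d3 := d T.i
  have d4 := d T.j
  have q1 : (S.i : ℚ) < T.j := by exact_mod_cast h₁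
  have q2 : (T.i : ℚ) < S.j := by exact_mod_cast h₂
  have q3 : (S.i : ℚ) < S.j := by exact_mod_cast hSij
  have q4 : (T.i : ℚ) < T.j := by exact_mod_cast hTij
  -- the difference of the two heights is affine, `≥ 0` at the ends of `S`, `≤ 0` at those of `T`
  have hs : S.slope - T.slope = 0 := by
    rcases lt_trichotomy (S.slope - T.slope) 0 with h | h | h
    · nlinarith [e1.1, e2.1, e3.1, e4.1]
    · exact h
    · nlinarith [e1.1, e2.1, e3.1, e4.1]
  rw [hs, zero_mul] at d1 d2 d3 d4
  have b1 := e1.2 (by linarith [e1.1, e2.1, e3.1, e4.1])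
  have b2 := e2.2 (by linarith [e1.1, e2.1, e3.1, e4.1])
  have b3 := e3.2 (by linarith [e1.1, e2.1, e3.1, e4.1])
  have b4 := e4.2 (by linarith [e1.1, e2.1, e3.1, e4.1])
  have hi : S.i = T.i := le_antisymm b1.1 b3.1
  have hj : S.j = T.j := le_antisymm b4.2 b2.2
  rw [hi, hTa] at hSa
  rw [hj, hTb] at hSb
  exact Segment.eq_of_ends hi hj (by exact_mod_cast hSa.symm) (by exact_mod_cast hSb.symm)

/-- A side of negative slope cannot pass beyond an abscissa where the valuation vanishes. -/
theorem IsPrincipalSide.right_le {p : ℕ} {F : ℤ[X]} {s : ℤ} {S : Segment}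
    (hS : IsPrincipalSide p F s S) {k : ℕ} (hk : val p F s k = 0) : S.j ≤ k := by
  by_contra! h
  have h0 : S.height k ≤ (0 : ℕ) := hS.height_le (by simpa using hk)
  have h1 := S.height_right hS.1
  have h2 := S.height_sub k S.j
  have h3 : (k : ℚ) < S.j := by exact_mod_cast h
  have h4 : (0 : ℚ) ≤ S.b := Nat.cast_nonneg _
  have := mul_pos_of_neg_of_neg hS.2.1 (sub_neg.2 h3)
  push_cast at h0
  linarith

theorem Segment.ram_dvd {S : Segment} (h : S.i < S.j) : S.ram ∣ S.j - S.i := by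
  have h1 := Rat.den_dvd ((S.b : ℤ) - S.a) ((S.j : ℤ) - S.i)
  have h2 : Rat.divInt ((S.b : ℤ) - S.a) ((S.j : ℤ) - S.i) = S.slope := by
    rw [Rat.divInt_eq_div]; simp [Segment.slope]
  rw [h2] at h1
  have h3 : ((S.j : ℤ) - S.i) = ((S.j - S.i : ℕ) : ℤ) := by omega
  rw [h3] at h1
  exact_mod_cast h1

/-! ### Residual coefficients -/

theorem residualCoeff_eq_intCast {p : ℕ} [hp : Fact p.Prime] {F : ℤ[X]} {s : ℤ} {S : Segment}
    {k h : ℕ} {c : ℤ} (hh : S.height k = h) (hc : coeffAt F s k = (p : ℤ) ^ h * c) :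
    residualCoeff p F s S k = (c : ZMod p) := by
  have hp0 : (p : ℤ) ^ h ≠ 0 := pow_ne_zero _ (by exact_mod_cast hp.out.ne_zero)
  unfold residualCoeff
  by_cases hd : (p : ℤ) ∣ c
  · rw [if_neg, (ZMod.intCast_zmod_eq_zero_iff_dvd c p).2 hd]
    rintro ⟨h1, h2⟩
    rw [hh] at h2
    have h3 : (h : ℕ∞) < val p F s k := by
      rw [natCast_lt_val_iff, hc, pow_succ]
      exact mul_dvd_mul_left _ hd
    rw [← ENat.natCast_toNat h1] at h3
    have h4 : h = (val p F s k).toNat := by exact_mod_cast h2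
    rw [← h4] at h3
    exact lt_irrefl _ h3
  · have hv : val p F s k = h := by
      rw [val_eq_natCast_iff, hc, pow_succ]
      exact ⟨dvd_mul_right _ _, fun h1 => hd ((mul_dvd_mul_iff_left hp0).1 h1)⟩
    rw [if_pos (by rw [hv]; exact ⟨ENat.natCast_ne_top h, by simpa using hh⟩), hv, hc]
    simp [Int.mul_ediv_cancel_left _ hp0]

theorem residualCoeff_ne_zero {p : ℕ} [hp : Fact p.Prime] {F : ℤ[X]} {s : ℤ} {S : Segment}
    {k h : ℕ} (hh : S.height k = h) (hv : val p F s k = h) : residualCoeff p F s S k ≠ 0 := by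
  obtain ⟨⟨c, hc⟩, h2⟩ := val_eq_natCast_iff.1 hv
  rw [residualCoeff_eq_intCast hh hc, Ne, ZMod.intCast_zmod_eq_zero_iff_dvd]
  intro hd
  apply h2
  rw [hc, pow_succ]
  exact mul_dvd_mul_left _ hd

theorem coeff_residualPoly (p : ℕ) (F : ℤ[X]) (s : ℤ) (S : Segment) (k : ℕ) :
    (residualPoly p F s S).coeff k =
      if k ≤ S.degree then residualCoeff p F s S (S.i + k * S.ram) else 0 := by
  simp [residualPoly, coeff_C_mul, coeff_X_pow]

theorem Segment.degree_mul_ram {S : Segment} (h : S.i < S.j) : S.degree * S.ram = S.j - S.i :=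
  Nat.div_mul_cancel (Segment.ram_dvd h)

theorem IsPrincipalSide.coeff_residualPoly_degree_ne_zero {p : ℕ} [Fact p.Prime] {F : ℤ[X]}
    {s : ℤ} {S : Segment} (hS : IsPrincipalSide p F s S) :
    (residualPoly p F s S).coeff S.degree ≠ 0 := by
  rw [coeff_residualPoly, if_pos le_rfl, Segment.degree_mul_ram hS.1,
    Nat.add_sub_cancel' hS.1.le]
  exact residualCoeff_ne_zero (Segment.height_right hS.1) hS.2.2.2.1

theorem IsPrincipalSide.natDegree_residualPoly {p : ℕ} [Fact p.Prime] {F : ℤ[X]} {s : ℤ}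
    {S : Segment} (hS : IsPrincipalSide p F s S) :
    (residualPoly p F s S).natDegree = S.degree := by
  refine le_antisymm (natDegree_le_iff_coeff_eq_zero.2 fun k hk => ?_)
    (le_natDegree_of_ne_zero hS.coeff_residualPoly_degree_ne_zero)
  rw [coeff_residualPoly, if_neg (by omega)]

theorem IsPrincipalSide.residualPoly_ne_zero {p : ℕ} [Fact p.Prime] {F : ℤ[X]} {s : ℤ}
    {S : Segment} (hS : IsPrincipalSide p F s S) : residualPoly p F s S ≠ 0 := fun h =>
  hS.coeff_residualPoly_degree_ne_zero (by rw [h, coeff_zero])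

/-! ### Polynomials of degree at most three with a multiple factor -/

section Field

variable {K : Type*} [Field K]

theorem separable_of_natDegree_le_one {R : K[X]} (h0 : R ≠ 0) (h : R.natDegree ≤ 1) :
    R.Separable := by
  rcases Nat.le_one_iff_eq_zero_or_eq_one.1 h with h | h
  · obtain ⟨c, rfl⟩ := natDegree_eq_zero.1 h
    exact (separable_C c).2 (isUnit_iff_ne_zero.2 (by simpa using h0))
  · have hd : R.degree = 1 := by rw [degree_eq_natDegree h0, h]; rfl
    have hd' : derivative R = C (R.coeff 1) := by
      conv_lhs => rw [eq_X_add_C_of_degree_eq_one hd]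
      rw [derivative_add, derivative_C_mul, derivative_X, derivative_C, leadingCoeff, h]; simp
    rw [Separable, hd']
    refine isCoprime_one_right.of_isCoprime_of_dvd_right ((isUnit_C).2 ?_).dvd
    rw [← h]
    exact isUnit_iff_ne_zero.2 (leadingCoeff_ne_zero.2 h0)

theorem exists_associated_X_sub_C_of_sq_dvd {R ψ : K[X]} (h0 : R ≠ 0) (h : R.natDegree ≤ 3)
    (hψ : Irreducible ψ) (hd : ψ ^ 2 ∣ R) : ∃ c : K, Associated ψ (X - C c) := by
  have h1 := natDegree_le_of_dvd hd h0
  rw [natDegree_pow] at h1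
  have h2 := hψ.natDegree_pos
  have h3 : ψ.degree = 1 := by
    rw [degree_eq_natDegree hψ.ne_zero, show ψ.natDegree = 1 by omega]; rfl
  obtain ⟨c, hc⟩ := exists_root_of_degree_eq_one h3
  exact ⟨c, ((irreducible_X_sub_C c).associated_of_dvd hψ (dvd_iff_isRoot.2 hc)).symm⟩

theorem exists_rootMultiplicity_ge_two [PerfectField K] {R : K[X]} (h0 : R ≠ 0)
    (h : R.natDegree ≤ 3) (hs : ¬ R.Separable) : ∃ c : K, 2 ≤ R.rootMultiplicity c := by
  rw [PerfectField.separable_iff_squarefree,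
    squarefree_iff_irreducible_sq_not_dvd_of_ne_zero h0] at hs
  push Not at hs
  obtain ⟨ψ, hψ, hd⟩ := hs
  rw [← pow_two] at hd
  obtain ⟨c, hc⟩ := exists_associated_X_sub_C_of_sq_dvd h0 h hψ hd
  exact ⟨c, (le_rootMultiplicity_iff h0).2 ((hc.pow_pow (n := 2)).symm.dvd.trans hd)⟩

theorem eq_of_two_le_rootMultiplicity {R : K[X]} (h0 : R ≠ 0) (h : R.natDegree ≤ 3) {c c' : K}
    (hc : 2 ≤ R.rootMultiplicity c) (hc' : 2 ≤ R.rootMultiplicity c') : c = c' := by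
  by_contra hne
  rw [le_rootMultiplicity_iff h0] at hc hc'
  have h1 : IsCoprime ((X - C c) ^ 2) ((X - C c') ^ 2) :=
    (isCoprime_X_sub_C_of_isUnit_sub (sub_ne_zero.2 hne).isUnit).pow
  have h2 := natDegree_le_of_dvd (h1.mul_dvd hc hc') h0
  rw [natDegree_mul (pow_ne_zero _ (X_sub_C_ne_zero c)) (pow_ne_zero _ (X_sub_C_ne_zero c')),
    natDegree_pow, natDegree_pow, natDegree_X_sub_C, natDegree_X_sub_C] at h2
  omega

end Field

/-! ### Irregular sides in the range of abscissas `0, …, 3` -/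

theorem IsIrregularSide.two_le_degree {p : ℕ} [Fact p.Prime] {F : ℤ[X]} {s : ℤ} {S : Segment}
    (hS : IsIrregularSide p F s S) : 2 ≤ S.degree := by
  by_contra! h
  refine hS.2 (separable_of_natDegree_le_one hS.1.residualPoly_ne_zero ?_)
  rw [hS.1.natDegree_residualPoly]; omega

theorem IsIrregularSide.ram_eq_one {p : ℕ} [Fact p.Prime] {F : ℤ[X]} {s : ℤ} {S : Segment}
    (hS : IsIrregularSide p F s S) (hj : S.j ≤ 3) : S.ram = 1 := by
  have h1 := hS.two_le_degree
  have h2 := Segment.degree_mul_ram hS.1.1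
  have h3 : 0 < S.ram := S.slope.den_pos
  nlinarith [Nat.sub_le S.j S.i]

theorem IsIrregularSide.degree_eq {p : ℕ} [Fact p.Prime] {F : ℤ[X]} {s : ℤ} {S : Segment}
    (hS : IsIrregularSide p F s S) (hj : S.j ≤ 3) : S.degree = S.j - S.i := by
  rw [← Segment.degree_mul_ram hS.1.1, hS.ram_eq_one hj, mul_one]

theorem IsIrregularSide.left_add_two_le {p : ℕ} [Fact p.Prime] {F : ℤ[X]} {s : ℤ} {S : Segment}
    (hS : IsIrregularSide p F s S) (hj : S.j ≤ 3) : S.i + 2 ≤ S.j := by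
  have := hS.two_le_degree
  have := hS.degree_eq hj
  omega

theorem IsIrregularSide.exists_slope_eq {p : ℕ} [Fact p.Prime] {F : ℤ[X]} {s : ℤ} {S : Segment}
    (hS : IsIrregularSide p F s S) (hj : S.j ≤ 3) :
    ∃ δ : ℕ, 0 < δ ∧ S.slope = -(δ : ℚ) := by
  have h1 : (S.slope.num : ℚ) = S.slope := Rat.den_eq_one_iff _ |>.1 (hS.ram_eq_one hj)
  have h2 : S.slope.num < 0 := Rat.num_neg.2 hS.1.2.1
  refine ⟨S.slope.num.natAbs, by omega, ?_⟩
  rw [← h1]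
  have h3 : S.slope.num = -(S.slope.num.natAbs : ℤ) := by omega
  exact_mod_cast h3

theorem iterationWellDefined_of_right_le {p : ℕ} [Fact p.Prime] {F : ℤ[X]} {s : ℤ}
    (hirr : ¬ IsRegularAt p F s) (hj : ∀ S, IsIrregularSide p F s S → S.j ≤ 3) :
    IterationWellDefined p F s := by
  constructor
  · simp only [IsRegularAt, not_forall] at hirr
    obtain ⟨S, hS, hR⟩ := hirr
    have hS' : IsIrregularSide p F s S := ⟨hS, hR⟩
    refine ⟨S, hS', fun T hT => ?_⟩
    have h1 := hS'.left_add_two_le (hj S hS')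
    have h2 := hT.left_add_two_le (hj T hT)
    have h3 := hj S hS'
    have h4 := hj T hT
    exact hT.1.eq_of_overlap hS (by omega) (by omega)
  · intro S hS
    have h0 := hS.1.residualPoly_ne_zero
    have hd : (residualPoly p F s S).natDegree ≤ 3 := by
      rw [hS.1.natDegree_residualPoly, hS.degree_eq (hj S hS)]
      have := hj S hS
      omega
    refine ⟨hS.exists_slope_eq (hj S hS), ?_, fun ψ hψ hψd =>
      exists_associated_X_sub_C_of_sq_dvd h0 hd hψ hψd⟩
    obtain ⟨c, hc⟩ := exists_rootMultiplicity_ge_two h0 hd hS.2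
    exact ⟨c, hc, fun c' hc' => eq_of_two_le_rootMultiplicity h0 hd hc' hc⟩

/-! ### Substitution along a side of integral slope -/

section IntegralSlope

variable {p : ℕ} {F : ℤ[X]} {s : ℤ} {S : Segment} {δ : ℕ}

theorem Segment.height_eq_of_slope (hij : S.i < S.j) (hδ : S.slope = -(δ : ℚ)) (k : ℕ) :
    S.height k + δ * k = S.b + δ * S.j := by
  have h1 := S.height_sub k S.j
  rw [Segment.height_right hij, hδ] at h1
  linarith

theorem IsPrincipalSide.pow_dvd_mul_coeffAt [Fact p.Prime] (hS : IsPrincipalSide p F s S)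
    (hδ : S.slope = -(δ : ℚ)) (k : ℕ) :
    (p : ℤ) ^ (S.b + δ * S.j) ∣ (p : ℤ) ^ (δ * k) * coeffAt F s k := by
  rcases eq_or_ne (val p F s k) ⊤ with hv | hv
  · rw [coeffAt_eq_zero_of_val_eq_top hv, mul_zero]; exact dvd_zero _
  obtain ⟨n, hn⟩ := ENat.ne_top_iff_exists.1 hv
  have h1 := hS.height_le hn.symm
  have h2 := Segment.height_eq_of_slope hS.1 hδ k
  have h3 : S.b + δ * S.j ≤ δ * k + n := by
    have : (S.b + δ * S.j : ℚ) ≤ δ * k + n := by linarith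
    exact_mod_cast this
  refine (pow_dvd_pow _ h3).trans ?_
  rw [pow_add]
  exact mul_dvd_mul_left _ (val_eq_natCast_iff.1 hn.symm).1

theorem IsPrincipalSide.pow_succ_dvd_mul_coeffAt [Fact p.Prime] (hS : IsPrincipalSide p F s S)
    (hδ : S.slope = -(δ : ℚ)) {k : ℕ} (hk : k < S.i ∨ S.j < k) :
    (p : ℤ) ^ (S.b + δ * S.j + 1) ∣ (p : ℤ) ^ (δ * k) * coeffAt F s k := by
  rcases eq_or_ne (val p F s k) ⊤ with hv | hv
  · rw [coeffAt_eq_zero_of_val_eq_top hv, mul_zero]; exact dvd_zero _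
  obtain ⟨n, hn⟩ := ENat.ne_top_iff_exists.1 hv
  have h1 : S.height k < n := by
    refine lt_of_le_of_ne (hS.height_le hn.symm) fun h => ?_
    have := (hS.2.2.2.2 k n hn.symm).2 h
    omega
  have h2 := Segment.height_eq_of_slope hS.1 hδ k
  have h3 : S.b + δ * S.j + 1 ≤ δ * k + n := by
    have : (S.b + δ * S.j : ℚ) < δ * k + n := by linarith
    exact_mod_cast this
  refine (pow_dvd_pow _ h3).trans ?_
  rw [pow_add]
  exact mul_dvd_mul_left _ (val_eq_natCast_iff.1 hn.symm).1

/-- The polynomial `F(s + p ^ δ z)` is divisible by `p ^ m`, where `m` is the height at the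
origin of the line of slope `-δ` through the side `S`; the quotient reduces modulo `p` to
`z ^ i` times the residual polynomial of `S`, where `i` is the left abscissa of `S`. -/
theorem IsPrincipalSide.exists_scaled [hp : Fact p.Prime] (hS : IsPrincipalSide p F s S)
    (hδ : S.slope = -(δ : ℚ)) :
    ∃ G : ℤ[X], (taylor s F).comp (C ((p : ℤ) ^ δ) * X) = C ((p : ℤ) ^ (S.b + δ * S.j)) * G ∧
      G.map (Int.castRingHom (ZMod p)) = X ^ S.i * residualPoly p F s S := by
  have hp0 : (p : ℤ) ≠ 0 := by exact_mod_cast hp.out.ne_zero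
  have hc (k : ℕ) : ((taylor s F).comp (C ((p : ℤ) ^ δ) * X)).coeff k =
      (p : ℤ) ^ (δ * k) * coeffAt F s k := by
    rw [comp_C_mul_X_coeff, coeffAt, pow_mul, mul_comm]
  obtain ⟨G, hG⟩ : C ((p : ℤ) ^ (S.b + δ * S.j)) ∣ (taylor s F).comp (C ((p : ℤ) ^ δ) * X) := by
    rw [C_dvd_iff_dvd_coeff]
    intro k
    rw [hc]
    exact hS.pow_dvd_mul_coeffAt hδ k
  refine ⟨G, hG, ?_⟩
  have hGc (k : ℕ) : (p : ℤ) ^ (δ * k) * coeffAt F s k =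
      (p : ℤ) ^ (S.b + δ * S.j) * G.coeff k := by
    rw [← hc, hG, coeff_C_mul]
  have hram : S.ram = 1 := by
    rw [Segment.ram, hδ]; simp
  have hdeg : S.degree = S.j - S.i := by
    rw [← Segment.degree_mul_ram hS.1, hram, mul_one]
  have hout (k : ℕ) (hk : k < S.i ∨ S.j < k) : ((G.coeff k : ℤ) : ZMod p) = 0 := by
    rw [ZMod.intCast_zmod_eq_zero_iff_dvd]
    have h := hS.pow_succ_dvd_mul_coeffAt hδ hk
    rw [hGc, pow_succ] at h
    exact (mul_dvd_mul_iff_left (pow_ne_zero _ hp0)).1 h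
  ext k
  rw [coeff_map, coeff_X_pow_mul', coeff_residualPoly, hram, hdeg, mul_one, eq_intCast]
  split_ifs with h1 h2
  · rw [Nat.add_sub_cancel' h1]
    have hkj : k ≤ S.j := by have := hS.1; omega
    have hm : S.b + δ * S.j = δ * k + (S.b + δ * (S.j - k)) := by
      obtain ⟨l, hl⟩ : ∃ l, S.j = k + l := ⟨S.j - k, by omega⟩
      rw [hl, Nat.add_sub_cancel_left]; ring
    have hh : S.height k = (S.b + δ * (S.j - k) : ℕ) := by
      have h3 := Segment.height_eq_of_slope hS.1 hδ k
      have h4 : (S.b + δ * S.j : ℚ) = δ * k + (S.b + δ * (S.j - k) : ℕ) := by exact_mod_cast hm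
      linarith
    refine (residualCoeff_eq_intCast hh ?_).symm
    have h5 := hGc k
    rw [hm, pow_add, mul_assoc] at h5
    exact mul_left_cancel₀ (pow_ne_zero _ hp0) h5
  · exact hout k (by omega)
  · exact hout k (by omega)

/-- After the substitution `s ↦ s + y p ^ δ`, with `y` a multiple root of the residual polynomial
of `S`, the points of abscissas `0` and `1` lie strictly above the line of slope `-δ` through `S`,
while the right end point of `S` is unchanged. -/
theorem IsPrincipalSide.step [hp : Fact p.Prime] (hS : IsPrincipalSide p F s S)
    (hδ : S.slope = -(δ : ℚ)) {y : ℤ}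
    (hy : IsMultipleRoot (residualPoly p F s S) (y : ZMod p)) :
    (∀ k < 2, (p : ℤ) ^ (S.b + δ * S.j + 1) ∣
      (p : ℤ) ^ (δ * k) * coeffAt F (s + y * (p : ℤ) ^ δ) k) ∧
    val p F (s + y * (p : ℤ) ^ δ) S.j = S.b := by
  have hp0 : (p : ℤ) ≠ 0 := by exact_mod_cast hp.out.ne_zero
  obtain ⟨G, hG, hGR⟩ := hS.exists_scaled hδ
  have hc (k : ℕ) : (p : ℤ) ^ (δ * k) * coeffAt F (s + y * (p : ℤ) ^ δ) k =
      (p : ℤ) ^ (S.b + δ * S.j) * (taylor y G).coeff k := by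
    have h1 : (taylor (s + y * (p : ℤ) ^ δ) F).comp (C ((p : ℤ) ^ δ) * X) =
        C ((p : ℤ) ^ (S.b + δ * S.j)) * taylor y G := by
      have h2 : C ((p : ℤ) ^ (S.b + δ * S.j)) * taylor y G =
          taylor y (C ((p : ℤ) ^ (S.b + δ * S.j)) * G) := by rw [taylor_mul, taylor_C]
      rw [h2, ← hG]
      simp only [taylor_apply, comp_assoc]
      congr 1
      simp
      ring
    rw [← coeff_C_mul, ← h1, comp_C_mul_X_coeff, coeffAt, pow_mul, mul_comm]
  have hmap (k : ℕ) : (((taylor y G).coeff k : ℤ) : ZMod p) =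
      (taylor (y : ZMod p) (X ^ S.i * residualPoly p F s S)).coeff k := by
    rw [← hGR, ← eq_intCast (Int.castRingHom (ZMod p)), ← coeff_map, map_taylor]; simp
  constructor
  · intro k hk
    rw [hc, pow_succ]
    refine mul_dvd_mul_left _ ((ZMod.intCast_zmod_eq_zero_iff_dvd _ p).1 ?_)
    rw [hmap]
    have h1 : (X - C (y : ZMod p)) ^ 2 ∣ X ^ S.i * residualPoly p F s S :=
      ((le_rootMultiplicity_iff hS.residualPoly_ne_zero).1 hy).mul_left _
    have h2 : X ^ 2 ∣ taylor (y : ZMod p) (X ^ S.i * residualPoly p F s S) := by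
      obtain ⟨Q, hQ⟩ := h1
      refine ⟨taylor (y : ZMod p) Q, ?_⟩
      rw [hQ]
      simp [taylor_apply]
    exact X_pow_dvd_iff.1 h2 k hk
  · have hram : S.ram = 1 := by
      rw [Segment.ram, hδ]; simp
    have hdeg : (X ^ S.i * residualPoly p F s S).natDegree = S.j := by
      rw [natDegree_mul (pow_ne_zero _ X_ne_zero) hS.residualPoly_ne_zero, natDegree_X_pow,
        hS.natDegree_residualPoly, ← mul_one S.degree, ← hram, Segment.degree_mul_ram hS.1,
        Nat.add_sub_cancel' hS.1.le]
    -- translating by `y` does not change the leading coefficient, of degree `S.j`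
    have hj : (taylor (y : ZMod p) (X ^ S.i * residualPoly p F s S)).coeff S.j ≠ 0 := by
      rw [← hdeg, ← natDegree_taylor _ (y : ZMod p), coeff_natDegree, leadingCoeff_taylor]
      exact leadingCoeff_ne_zero.2
        (mul_ne_zero (pow_ne_zero _ X_ne_zero) hS.residualPoly_ne_zero)
    rw [← hmap, Ne, ZMod.intCast_zmod_eq_zero_iff_dvd] at hj
    have h1 := hc S.j
    rw [add_comm S.b, pow_add, mul_assoc] at h1
    have h2 := mul_left_cancel₀ (pow_ne_zero _ hp0) h1
    rw [val_eq_natCast_iff, h2, pow_succ]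
    exact ⟨dvd_mul_right _ _, fun h => hj ((mul_dvd_mul_iff_left (pow_ne_zero _ hp0)).1 h)⟩

end IntegralSlope

/-! ### Iterations strictly increase the slope -/

section Progress

variable {p : ℕ} [hp : Fact p.Prime] {F : ℤ[X]} {s : ℤ} {S : Segment} {δ : ℕ}

/-- Under a side of slope `-δ` ending at an abscissa `≥ 2`, both `F(s)` and `F'(s)` are divisible
by `p ^ δ`. -/
theorem IsPrincipalSide.pow_dvd_coeffAt (hS : IsPrincipalSide p F s S)
    (hδ : S.slope = -(δ : ℚ)) (hj : 2 ≤ S.j) {k : ℕ} (hk : k < 2) :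
    (p : ℤ) ^ δ ∣ coeffAt F s k := by
  have hp0 : (p : ℤ) ≠ 0 := by exact_mod_cast hp.out.ne_zero
  have h := hS.pow_dvd_mul_coeffAt hδ k
  have h1 : δ * k + δ ≤ S.b + δ * S.j := by nlinarith
  have h2 := (pow_dvd_pow (p : ℤ) h1).trans h
  rw [pow_add] at h2
  exact (mul_dvd_mul_iff_left (pow_ne_zero _ hp0)).1 h2

/-- After an iteration along a side `S` of slope `-δ`, any side starting at an abscissa `0` or `1`
is steeper than `S`: its left end point is strictly above the line through `S`, but it has to
pass below the right end point of `S`. -/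
theorem IsPrincipalSide.slope_lt_of_step (hS : IsPrincipalSide p F s S)
    (hδ : S.slope = -(δ : ℚ)) (hj : 2 ≤ S.j) {y : ℤ}
    (hy : IsMultipleRoot (residualPoly p F s S) (y : ZMod p)) {T : Segment}
    (hT : IsPrincipalSide p F (s + y * (p : ℤ) ^ δ) T) (hi : T.i < 2) :
    T.slope < S.slope := by
  have hp0 : (p : ℤ) ≠ 0 := by exact_mod_cast hp.out.ne_zero
  obtain ⟨h1, h2⟩ := hS.step hδ hy
  obtain ⟨⟨c, hc⟩, hv⟩ := val_eq_natCast_iff.1 hT.2.2.1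
  have h3 : S.b + δ * S.j + 1 ≤ δ * T.i + T.a := by
    by_contra! h
    have h4 := (pow_dvd_pow (p : ℤ) (show δ * T.i + (T.a + 1) ≤ _ by omega)).trans (h1 T.i hi)
    rw [pow_add] at h4
    exact hv ((mul_dvd_mul_iff_left (pow_ne_zero _ hp0)).1 h4)
  have h3' : (S.b : ℚ) + δ * S.j + 1 ≤ δ * T.i + T.a := by exact_mod_cast h3
  have h4 := hT.height_le h2
  have h5 := T.height_sub S.j T.i
  rw [T.height_left] at h5
  rw [hδ]
  have h6 : (T.i : ℚ) < S.j := by exact_mod_cast hi.trans_le hj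
  by_contra! h
  nlinarith [mul_nonneg (sub_nonneg.2 h) (sub_pos.2 h6).le]

end Progress

/-! ### Persistence of the initial conditions -/

theorem coeffAt_add {F : ℤ[X]} (hdeg : F.natDegree = 4) (s q : ℤ) (k : ℕ) :
    coeffAt F (s + q) k =
      ∑ l ∈ Finset.range 5, (l.choose k : ℤ) * coeffAt F s l * q ^ (l - k) := by
  have h : taylor (s + q) F = taylor q (taylor s F) := by rw [taylor_taylor, add_comm]
  rw [coeffAt, h, taylor_coeff, hasseDeriv_apply, sum_over_range' _ _ 5, eval_finsetSum]
  · simp [coeffAt]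
  · rw [natDegree_taylor, hdeg]; norm_num
  · simp

theorem coeffAt_four {F : ℤ[X]} (hmonic : F.Monic) (hdeg : F.natDegree = 4) (s : ℤ) :
    coeffAt F s 4 = 1 := by
  rw [coeffAt, ← hdeg, ← natDegree_taylor F s, coeff_natDegree, leadingCoeff_taylor]
  exact hmonic

theorem coeffAt_of_four_lt {F : ℤ[X]} (hdeg : F.natDegree = 4) (s : ℤ) {k : ℕ} (hk : 4 < k) :
    coeffAt F s k = 0 :=
  coeff_eq_zero_of_natDegree_lt (by rwa [natDegree_taylor, hdeg])

section Persistence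

variable {p : ℕ} [hp : Fact p.Prime] {F : ℤ[X]} {s : ℤ} {S : Segment}

theorem val_four (hmonic : F.Monic) (hdeg : F.natDegree = 4) (s : ℤ) : val p F s 4 = 0 := by
  rw [val_eq_zero_iff, coeffAt_four hmonic hdeg]
  exact fun h => (Nat.prime_iff_prime_int.1 hp.out).not_isUnit (isUnit_of_dvd_one h)

/-- In the situation of condition (iii), an irregular side lies to the left of the side over
`[2, 4]`. -/
theorem IsIrregularSide.right_le_two (hmonic : F.Monic) (hdeg : F.natDegree = 4)
    (hS : IsIrregularSide p F s S) {T : Segment} (hT : IsPrincipalSide p F s T) (hi : T.i = 2)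
    (hj : T.j = 4) (hsep : (residualPoly p F s T).Separable) : S.j ≤ 2 := by
  by_contra! h
  have h4 := hS.1.right_le (val_four hmonic hdeg s)
  have := hS.1.1
  exact hS.2 (hS.1.eq_of_overlap hT (by omega) (by omega) ▸ hsep)

theorem InitialCondition.right_le_three (hmonic : F.Monic) (hdeg : F.natDegree = 4)
    (hs : InitialCondition p F s) (hS : IsIrregularSide p F s S) : S.j ≤ 3 := by
  rcases hs with h | h | ⟨-, -, -, -, T, hT, hi, hj, -, hsep⟩
  · exact (hS.1.right_le h.1).trans (by norm_num)
  · exact hS.1.right_le h.1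
  · exact (hS.right_le_two hmonic hdeg hT hi hj hsep).trans (by norm_num)

theorem Segment.height_of_ends {T : Segment} (hi : T.i = 2) (hj : T.j = 4) (hb : T.b = 0)
    (k : ℕ) : T.height k = 2 * T.a - T.a / 2 * k := by
  simp only [Segment.height, Segment.slope, hi, hj, hb]
  push_cast
  ring

/-- A residual coefficient depends only on the coefficient modulo the first power of `p` whose
exponent exceeds the height of the side. -/
theorem residualCoeff_congr {t : ℤ} {k n : ℕ} (hn : (S.height k) < n)
    (hs : ∀ l : ℕ, val p F s k = l → S.height k ≤ l)
    (h : (p : ℤ) ^ n ∣ coeffAt F t k - coeffAt F s k) :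
    residualCoeff p F t S k = residualCoeff p F s S k := by
  by_cases hh : ∃ m : ℕ, S.height k = m
  · obtain ⟨m, hm⟩ := hh
    rw [hm] at hn
    have hmn : m + 1 ≤ n := by exact_mod_cast hn
    have h1 : (p : ℤ) ^ m ∣ coeffAt F s k := by
      rw [← natCast_le_val_iff]
      rcases eq_or_ne (val p F s k) ⊤ with hv | hv
      · rw [hv]; exact le_top
      · obtain ⟨l, hl⟩ := ENat.ne_top_iff_exists.1 hv
        have := hs l hl.symm
        rw [hm] at this
        rw [← hl]
        exact_mod_cast this
    obtain ⟨c, hc⟩ := h1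
    obtain ⟨d, hd⟩ := (pow_dvd_pow (p : ℤ) hmn).trans h
    have hc' : coeffAt F t k = (p : ℤ) ^ m * (c + p * d) := by
      rw [eq_add_of_sub_eq hd, hc]; ring
    rw [residualCoeff_eq_intCast hm hc, residualCoeff_eq_intCast hm hc']
    simp
  · rw [residualCoeff, if_neg fun h => hh ⟨_, h.2⟩, residualCoeff, if_neg fun h => hh ⟨_, h.2⟩]

/-- Conditions (i) and (ii) depend only on `F` and `s` modulo `p`. In case
(iii) the irregular side is the one over `[0, 2]`; its slope is so steep that the iteration leaves
the side over `[2, 4]` and its residual polynomial untouched. -/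
theorem InitialCondition.step (hmonic : F.Monic) (hdeg : F.natDegree = 4) {t : ℤ}
    (hs : InitialCondition p F s) (hst : IterationStep p F s t) : InitialCondition p F t := by
  obtain ⟨S, δ, y, hS, hδ, hy, rfl⟩ := hst
  have hp0 : (p : ℤ) ≠ 0 := by exact_mod_cast hp.out.ne_zero
  have hδ0 : 0 < δ := by
    have := hS.1.2.1
    rw [hδ, neg_lt_zero] at this
    exact_mod_cast this
  have hdvd : (p : ℤ) ∣ s + y * (p : ℤ) ^ δ - s := by
    rw [add_sub_cancel_left]
    exact (dvd_pow_self _ hδ0.ne').mul_left y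
  rcases hs with h | h | ⟨h0, h1, h3, h2, T, hT, hi, hj, hb, hsep⟩
  · left
    rwa [val_eq_zero_congr hdvd, val_pos_congr hdvd, val_pos_congr hdvd]
  · right; left
    rwa [val_eq_zero_congr hdvd, val_pos_congr hdvd, val_pos_congr hdvd, val_pos_congr hdvd]
  -- In case (iii) the irregular side is `[0, 2]`, and it is steeper than the side `T = [2, 4]`,
  -- of slope `-T.a / 2`.
  right; right
  have hSj : S.j ≤ 2 := hS.right_le_two hmonic hdeg hT hi hj hsep
  have hSi := hS.left_add_two_le (hSj.trans (by norm_num))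
  have hSi0 : S.i = 0 := by omega
  have hSj2 : S.j = 2 := by omega
  have hTa : val p F s 2 = T.a := by rw [← hi]; exact hT.2.2.1
  have hSb : S.b = T.a := by
    have := hS.1.2.2.2.1
    rw [hSj2, hTa] at this
    exact_mod_cast this.symm
  have hSa : S.a = S.b + δ * 2 := by
    have := Segment.height_eq_of_slope hS.1.1 hδ S.i
    rw [S.height_left, hSi0, hSj2] at this
    push_cast at this
    rw [mul_zero, add_zero] at this
    exact_mod_cast this
  have haδ : T.a < 2 * δ := by
    have h4 : val p F s 0 = S.a := by rw [← hSi0]; exact hS.1.2.2.1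
    rw [h4, hTa] at h0
    have : 2 * T.a < S.a := by exact_mod_cast h0
    omega
  obtain ⟨hstep, hval⟩ := hS.1.step hδ hy
  rw [hSj2] at hval
  rw [hSj2, hSb] at hstep
  set q : ℤ := y * (p : ℤ) ^ δ with hq
  have hqd : (p : ℤ) ^ δ ∣ q := dvd_mul_left _ _
  have h3t : (p : ℤ) ^ δ ∣ coeffAt F (s + q) 3 - coeffAt F s 3 :=
    hqd.trans (by simpa using sub_dvd_coeffAt_sub F s (s + q) 3)
  have hdvd3 (n : ℕ) (hn : 2 * n < T.a + 2) : (p : ℤ) ^ n ∣ coeffAt F s 3 := by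
    rw [← natCast_le_val_iff]
    rcases eq_or_ne (val p F s 3) ⊤ with hv | hv
    · rw [hv]; exact le_top
    · obtain ⟨l, hl⟩ := ENat.ne_top_iff_exists.1 hv
      rw [hTa, ← hl] at h3
      rw [← hl]
      have h5 : T.a ≤ 2 * l := by exact_mod_cast h3
      have h6 : n ≤ l := by omega
      exact_mod_cast h6
  -- `u₂ + 1 ≤ v(a₃) + δ` and `u₂ + 1 ≤ 2 δ`, so that `a₂` changes only modulo `p ^ (u₂ + 1)`.
  have h2t : (p : ℤ) ^ (T.a + 1) ∣ coeffAt F (s + q) 2 - coeffAt F s 2 := by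
    have h4 : coeffAt F (s + q) 2 - coeffAt F s 2 = 3 * (coeffAt F s 3 * q) + 6 * (q * q) := by
      rw [coeffAt_add hdeg]
      simp [Finset.sum_range_succ, coeffAt_four hmonic hdeg, Nat.choose]
      ring
    rw [h4]
    have hq2 : (p : ℤ) ^ (T.a + 1) ∣ q * q := by
      refine (pow_dvd_pow _ (show T.a + 1 ≤ δ + δ by omega)).trans ?_
      rw [pow_add]
      exact mul_dvd_mul hqd hqd
    have hq3 : (p : ℤ) ^ (T.a + 1) ∣ coeffAt F s 3 * q := by
      refine (pow_dvd_pow _ (show T.a + 1 ≤ (T.a + 1) / 2 + δ by omega)).trans ?_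
      rw [pow_add]
      exact mul_dvd_mul (hdvd3 _ (by omega)) hqd
    exact dvd_add (hq3.mul_left _) (hq2.mul_left _)
  have hv2 : val p F (s + q) 2 = T.a := by rw [hval, hSb]
  have hv0 : ((T.a + δ * 2 : ℕ) : ℕ∞) < val p F (s + q) 0 := by
    rw [natCast_lt_val_iff]
    simpa using hstep 0 (by norm_num)
  have hv1 : ((T.a + δ : ℕ) : ℕ∞) < val p F (s + q) 1 := by
    rw [natCast_lt_val_iff]
    have h4 := hstep 1 (by norm_num)
    rw [show T.a + δ * 2 + 1 = δ * 1 + (T.a + δ + 1) by ring, pow_add] at h4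
    exact (mul_dvd_mul_iff_left (pow_ne_zero _ hp0)).1 h4
  have hv3 : (((T.a + 1) / 2 : ℕ) : ℕ∞) ≤ val p F (s + q) 3 := by
    rw [natCast_le_val_iff, ← dvd_iff_dvd_of_dvd_sub
      (dvd_sub_comm.1 ((pow_dvd_pow _ (by omega)).trans h3t))]
    exact hdvd3 _ (by omega)
  have hv4 : val p F (s + q) 4 = 0 := val_four hmonic hdeg _
  have hH := Segment.height_of_ends hi hj hb
  -- Hence `T` is still a side, with the same residual polynomial.
  have hTt : IsPrincipalSide p F (s + q) T := by
    refine ⟨hT.1, hT.2.1, by rw [hi, hv2], by rw [hj, hb, hv4]; rfl, fun k n hkn => ?_⟩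
    have hk : k ≤ 4 := by
      by_contra! hk
      have h5 := coeffAt_of_four_lt hdeg (s + q) hk
      rw [val, h5, emultiplicity_zero] at hkn
      exact ENat.natCast_ne_top n hkn.symm
    have key : T.height k ≤ n ∧ (k < 2 → T.height k < n) := by
      rw [hH]
      interval_cases k
      · rw [hkn] at hv0
        have : T.a + δ * 2 < n := by exact_mod_cast hv0
        have h5 : (2 * T.a : ℚ) < n := by exact_mod_cast (show 2 * T.a < n by omega)
        constructor <;> intros <;> push_cast <;> linarith
      · rw [hkn] at hv1
        have : T.a + δ < n := by exact_mod_cast hv1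
        have h5 : (3 * T.a : ℚ) < 2 * n := by exact_mod_cast (show 3 * T.a < 2 * n by omega)
        constructor <;> intros <;> push_cast <;> linarith
      · rw [hkn] at hv2
        have h5 : (n : ℚ) = T.a := by exact_mod_cast hv2
        rw [h5]
        refine ⟨?_, by omega⟩
        push_cast; linarith
      · rw [hkn] at hv3
        have : (T.a + 1) / 2 ≤ n := by exact_mod_cast hv3
        have h5 : (T.a : ℚ) ≤ 2 * n := by exact_mod_cast (show T.a ≤ 2 * n by omega)
        refine ⟨?_, by omega⟩
        push_cast; linarith
      · refine ⟨?_, by omega⟩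
        have : (0 : ℚ) ≤ n := Nat.cast_nonneg _
        push_cast; linarith
    refine ⟨key.1, fun h => ⟨?_, by omega⟩⟩
    by_contra! h5
    exact (key.2 (by omega)).ne h
  have hres (k : ℕ) (hk2 : 2 ≤ k) (hk4 : k ≤ 4) :
      residualCoeff p F (s + q) T k = residualCoeff p F s T k := by
    have haQ : (T.a : ℚ) < 2 * δ := by exact_mod_cast haδ
    have haQ0 : (0 : ℚ) ≤ T.a := Nat.cast_nonneg _
    interval_cases k
    · refine residualCoeff_congr (n := T.a + 1) ?_ (fun l hl => hT.height_le hl) h2t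
      rw [hH]; push_cast; linarith
    · refine residualCoeff_congr (n := δ) ?_ (fun l hl => hT.height_le hl) h3t
      rw [hH]; push_cast; linarith
    · refine residualCoeff_congr (n := 1) ?_ (fun l hl => hT.height_le hl) ?_
      · rw [hH]; push_cast; linarith
      · rw [coeffAt_four hmonic hdeg, coeffAt_four hmonic hdeg]; simp
  have hpoly : residualPoly p F (s + q) T = residualPoly p F s T := by
    refine Finset.sum_congr rfl fun k hk => ?_
    have h5 := Segment.degree_mul_ram hT.1
    have h6 : k ≤ T.degree := Nat.lt_succ_iff.1 (Finset.mem_range.1 hk)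
    have h7 := Nat.mul_le_mul_right T.ram h6
    rw [hres _ (by omega) (by omega)]
  have ha0 : 0 < T.a := by
    rw [hTa] at h2
    exact_mod_cast h2
  rw [hv2]
  refine ⟨?_, ?_, ?_, by exact_mod_cast ha0, T, hTt, hi, hj, hb, by rwa [hpoly]⟩
  · refine lt_of_le_of_lt ?_ hv0
    exact_mod_cast (show 2 * T.a ≤ T.a + δ * 2 by omega)
  · rcases eq_or_ne (val p F (s + q) 1) ⊤ with hv | hv
    · rw [hv]; exact_mod_cast (ENat.natCast_lt_top (3 * T.a))
    · obtain ⟨l, hl⟩ := ENat.ne_top_iff_exists.1 hv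
      rw [← hl] at hv1 ⊢
      have : T.a + δ < l := by exact_mod_cast hv1
      exact_mod_cast (show 3 * T.a < 2 * l by omega)
  · refine le_trans ?_ (mul_le_mul_right hv3 2)
    exact_mod_cast (show T.a ≤ 2 * ((T.a + 1) / 2) by omega)

end Persistence

/-! ### Termination -/

/-- A monic irreducible integral polynomial is separable over `ℚ`; clearing denominators, it
satisfies a Bézout identity with its derivative, with a nonzero integer in place of the
discriminant. -/
theorem exists_bezout_derivative {F : ℤ[X]} (hmonic : F.Monic) (hirr : Irreducible F) :
    ∃ (A B : ℤ[X]) (N : ℤ), N ≠ 0 ∧ A * F + B * derivative F = C N := by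
  have h1 := ((hmonic.irreducible_iff_irreducible_map_fraction_map (K := ℚ)).1 hirr).separable
  obtain ⟨a, b, hab⟩ := h1
  obtain ⟨m, hm, hA⟩ := IsLocalization.integerNormalization_spec (nonZeroDivisors ℤ) a
  obtain ⟨n, hn, hB⟩ := IsLocalization.integerNormalization_spec (nonZeroDivisors ℤ) b
  set A := IsLocalization.integerNormalization (nonZeroDivisors ℤ) a
  set B := IsLocalization.integerNormalization (nonZeroDivisors ℤ) b
  refine ⟨C n * A, C m * B, m * n,
    mul_ne_zero (nonZeroDivisors.ne_zero hm) (nonZeroDivisors.ne_zero hn), ?_⟩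
  apply map_injective (algebraMap ℤ ℚ) (algebraMap ℤ ℚ).injective_int
  simp only [Polynomial.map_add, Polynomial.map_mul, hA, hB, map_C, ← derivative_map]
  have e (r : ℤ) (f : ℚ[X]) : r • f = C (algebraMap ℤ ℚ r) * f := by
    rw [zsmul_eq_mul]; simp
  rw [e, e, map_mul, C_mul]
  linear_combination (C (algebraMap ℤ ℚ m) * C (algebraMap ℤ ℚ n)) * hab

/-- The values of `F` and of its derivative at an integer cannot both be divisible by an
arbitrarily large power of `p`. -/
theorem exists_not_pow_dvd_coeffAt {p : ℕ} [hp : Fact p.Prime] {F : ℤ[X]} (hmonic : F.Monic)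
    (hirr : Irreducible F) :
    ∃ n : ℕ, ∀ s : ℤ, ¬ ((p : ℤ) ^ n ∣ coeffAt F s 0 ∧ (p : ℤ) ^ n ∣ coeffAt F s 1) := by
  obtain ⟨A, B, N, hN, hAB⟩ := exists_bezout_derivative hmonic hirr
  have hfin : FiniteMultiplicity (p : ℤ) N :=
    Int.finiteMultiplicity_iff.2 ⟨by simpa using hp.out.ne_one, hN⟩
  obtain ⟨n, hn⟩ := hfin
  refine ⟨n + 1, fun s ⟨h0, h1⟩ => hn ?_⟩
  rw [coeffAt, taylor_coeff_zero] at h0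
  rw [coeffAt, taylor_coeff_one] at h1
  have h2 := congrArg (eval s) hAB
  simp only [eval_add, eval_mul, eval_C] at h2
  rw [← h2]
  exact dvd_add (h0.mul_left _) (h1.mul_left _)

end OrePolygon

open OrePolygon in
theorem lemma3p2 (p : ℕ) [Fact p.Prime] (F : Polynomial ℤ) (hmonic : F.Monic)
    (hirr : Irreducible F) (hdeg : F.natDegree = 4) (s : ℤ)
    (hs : OrePolygon.InitialCondition p F s) (hirreg : ¬ OrePolygon.IsRegularAt p F s) :
    -- the procedure can be applied as long as the current integer is irregular
    (∀ m : ℤ, Relation.ReflTransGen (OrePolygon.IterationStep p F) s m →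
      OrePolygon.InitialCondition p F m ∧
      (¬ OrePolygon.IsRegularAt p F m → OrePolygon.IterationWellDefined p F m)) ∧
    -- whatever choices of the lifts are made, it stops at a regular integer
    (∀ a : ℕ → ℤ, a 0 = s →
      (∀ n : ℕ, ¬ OrePolygon.IsRegularAt p F (a n) →
        OrePolygon.IterationStep p F (a n) (a (n + 1))) →
      ∃ n : ℕ, OrePolygon.IsRegularAt p F (a n)) := by
  have persist : ∀ m : ℤ, Relation.ReflTransGen (IterationStep p F) s m →
      InitialCondition p F m := by
    intro m hm
    induction hm with
    | refl => exact hs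
    | tail _ hst ih => exact ih.step hmonic hdeg hst
  refine ⟨fun m hm => ⟨persist m hm, fun hirr => iterationWellDefined_of_right_le hirr
    fun S hS => (persist m hm).right_le_three hmonic hdeg hS⟩, fun a ha0 ha => ?_⟩
  by_contra! hreg
  have hic (n : ℕ) : InitialCondition p F (a n) := by
    refine persist _ ?_
    induction n with
    | zero => rw [ha0]
    | succ n ih => exact ih.tail (ha n (hreg n))
  choose S δ y hS hδ hy hstep using fun n => ha n (hreg n)
  have hj (n : ℕ) : (S n).j ≤ 3 := (hic n).right_le_three hmonic hdeg (hS n)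
  have hi (n : ℕ) := (hS n).left_add_two_le (hj n)
  have hmono : StrictMono δ := by
    refine strictMono_nat_of_lt_succ fun n => ?_
    have h1 := (hS (n + 1)).1
    rw [hstep n] at h1
    have h2 := (hS n).1.slope_lt_of_step (hδ n) (by have := hi n; omega) (hy n) h1
      (by have := hi (n + 1); have := hj (n + 1); omega)
    rw [hδ, hδ, neg_lt_neg_iff] at h2
    exact_mod_cast h2
  obtain ⟨n, hn⟩ := exists_not_pow_dvd_coeffAt (p := p) hmonic hirr
  have hdvd (k : ℕ) (hk : k < 2) : (p : ℤ) ^ n ∣ coeffAt F (a n) k :=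
    (pow_dvd_pow _ hmono.le_apply).trans
      ((hS n).1.pow_dvd_coeffAt (hδ n) (by have := hi n; omega) hk)
  exact hn (a n) ⟨hdvd 0 (by norm_num), hdvd 1 (by norm_num)⟩
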